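/- **Setting.** Consider a stationary Markov decision model with state space $\mathbb R$, action space $A$ (a Borel space, i.e. a separable metrizable space whose Borel $\sigma$-algebra is standard Borel), a measurable set $D\subseteq\mathbb R\times A$ of admissible state-action pairs that contains the graph of a measurable map $\mathbb R\to A$, sections $D(x)=\{a:(x,a)\in D\}$, i.i.d. disturbances $Z_1,Z_2,\dots$ (distributed as $Z$) with values in a measurable space $\mathcal Z$, a measurable transition function $T:D\times\mathcal Z\to\mathbb R$, a measurable one-stage cost $c:D\times\mathbb R\to[0,\infty)$, no terminal cost, and a discount factor $\beta>0$. Let $g:\mathbb R\to\mathbb R$ be increasing and convex with $g(0)\ge 0$ (all monotonicity is in the weak sense), and put $g(\infty)=\lim_{r\to\infty}g(r)$. Suppose that * the sets $D(x)$ are compact; $x\mapsto D(x)$ is increasing ($D(x)\subseteq D(y)$ for $x\le y$) and upper semicontinuous (if $x_k\to x$ and $a_k\in D(x_k)$, then $(a_k)$ has an accumulation point in $D(x)$); * for every $z\in\mathcal Z$, $T(\cdot,\cdot,z)$ is upper semicontinuous on $D$ and increasing in $x$; * for every $z\in\mathcal Z$, $(x,a)\mapsto c(x,a,T(x,a,z))$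 is lower semicontinuous on $D$ and decreasing in $x$. **Extended model.** Let $\widehat E=\mathbb R\times[0,\infty)\times(0,\infty)$ and $$\widehat T(x,s,t,a,z)=\big(T(x,a,z),\ s+t\,c(x,a,T(x,a,z)),\ \beta t\big).$$ A feasible history up to time $n$ is $h_n=(x_0,s_0,t_0,a_0,x_1,s_1,t_1,\dots,a_{n-1},x_n,s_n,t_n)$ with $(x_k,s_k,t_k)\in\widehat E$ and $a_k\in D(x_k)$. A decision rule at time $n$ is a measurable map $d_n$ from feasible histories up to time $n$ to $A$ with $d_n(h_n)\in D(x_n)$; a Markov decision rule is a measurable map $d:\widehat E\to A$ with $d(x,s,t)\in D(x)$. A policy $\pi=(d_0,d_1,\dots)$ (or $(d_0,\dots,d_{N-1})$) is a sequence of decision rules, and it is Markov if all of them are Markov. The extended state moves by $\widehat T$ with $Z_{n+1}$ driving the step from time $n$ to $n+1$. For a horizon $N\in\mathbb N$ and $n\le N$, let $$V_{n\pi}(h_n)=\mathbb E\Big[g\Big(s_n+t_n\sum_{k=n}^{N-1}\beta^{k-n}c(X_k,d_k(H_k),X_{k+1})\Big)\Big],\qquad V_n(h_n)=\inf_\pi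 V_{n\pi}(h_n),$$ where the history at time $n$ is $h_n$ and the infimum is over all policies. Let $J_{n\pi}(x,s,t)$ be the same expectation for a Markov policy $\pi$ started at time $n$ in $(x,s,t)\in\widehat E$, and $J_n=\inf_\pi J_{n\pi}$ over Markov policies. We write $J_n=J_n^{(N)}$ when the horizon has to be shown. For the infinite horizon let $$J_{\infty\pi}(x,s,t)=\mathbb E\Big[g\Big(s+t\sum_{k=0}^{\infty}\beta^kc(X_k,d_k(X_k,s_k,t_k),X_{k+1})\Big)\Big],\qquad J_\infty=\inf_\pi J_{\infty\pi}$$ over Markov policies $\pi$, the process starting at time $0$ in $(x,s,t)$. All values lie in $[0,\infty]$. For $v:\widehat E\to[0,\infty]$ let $Lv(x,s,t,a)=\mathbb E[v(\widehat T(x,s,t,a,Z))]$, $\mathcal T_dv(x,s,t)=Lv(x,s,t,d(x,s,t))$ for a Markov decision rule $d$, and $\mathcal Tv(x,s,t)=\inf_{a\in D(x)}Lv(x,s,t,a)$. Let $\mathbb M$ be the set of lower semicontinuous $v:\widehat E\to[0,\infty]$ that are increasing in $(s,t)$ for each $x$ and satisfy $v(x,s,t)\ge g(s)$. **Corollary.**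 1. *(Finite horizon.)* Let $N\in\mathbb N$. For $n=0,\dots,N$: $V_n(h_n)=J_n(x_n,s_n,t_n)$ for every feasible history $h_n$; $J_n\in\mathbb M$; and $J_n$ is decreasing in $x$ and increasing in $(s,t)$. The Bellman equation holds: $J_N(x,s,t)=g(s)$ and $J_n=\mathcal TJ_{n+1}$ for $n=0,\dots,N-1$. For $n=0,\dots,N-1$ there are Markov decision rules $d_n^*$ with $\mathcal T_{d_n^*}J_{n+1}=\mathcal TJ_{n+1}$, and every sequence of such minimizers forms an optimal policy $\pi^*=(d_0^*,\dots,d_{N-1}^*)$: $V_{n\pi^*}(h_n)=V_n(h_n)$ for all $n\le N$ and all feasible $h_n$. 2. *(Infinite horizon.)* $J_\infty$ is the smallest fixed point of $\mathcal T$ in $\mathbb M$, and $J_\infty=\lim_{N\to\infty}J_0^{(N)}$ pointwise. There is a Markov decision rule $d^*$ with $\mathcal T_{d^*}J_\infty=\mathcal TJ_\infty$, and for every such $d^*$ the stationary policy $\pi^*=(d^*,d^*,\dots)$ is optimal: $J_{\infty\pi^*}=J_\infty$. Moreover $J_\infty$ is decreasing in $x$ and increasing in $(s,t)$. 3. *(Convexity.)*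 If in addition $A$ is a subset of a real vector space, $D$ is convex, and, for every $z\in\mathcal Z$, $T(\cdot,\cdot,z)$ is concave and $(x,a)\mapsto c(x,a,T(x,a,z))$ is convex on $D$, then $J_n(\cdot,\cdot,t)$ (for all $N$ and $n\le N$) and $J_\infty(\cdot,\cdot,t)$ are convex in $(x,s)$ for every $t>0$. -/

import Mathlib

open MeasureTheory ProbabilityTheory Filter Topology
open scoped NNReal ENNReal

namespace MarkovDecision

universe u v w

/-- The extended state space `ℝ × ℝ₊ × (0,∞)`; a point is `(x, s, t)` with `x` the state of the
decision model, `s` the cost accumulated so far and `t` the current discount weight. -/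
abbrev ExtState : Type := ℝ × ℝ≥0 × Set.Ioi (0 : ℝ≥0)

/-- A stationary Markov decision model with state space `ℝ`, action space `A`, disturbance space
`S`, no terminal cost, and discount factor `β > 0`. The transition function `T` and the one-stage
cost `c` are only ever used (and only constrained) at pairs `(x, a) ∈ D`. -/
structure Model (A : Type u) (S : Type v) (Ω : Type w)
    [MeasurableSpace A] [MeasurableSpace S] [MeasurableSpace Ω] where
  /-- the underlying probability measure -/
  P : Measure Ω
  isProbabilityMeasure_P : IsProbabilityMeasure P
  /-- the disturbances; `Z n` drives the transition from time `n` to time `n + 1` -/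
  Z : ℕ → Ω → S
  measurable_Z : ∀ n, Measurable (Z n)
  indep_Z : iIndepFun Z P
  identDistrib_Z : ∀ n, IdentDistrib (Z n) (Z 0) P P
  /-- the admissible state-action pairs -/
  D : Set (ℝ × A)
  measurableSet_D : MeasurableSet D
  exists_graph_subset_D : ∃ f : ℝ → A, Measurable f ∧ ∀ x, (x, f x) ∈ D
  /-- the transition function -/
  T : ℝ → A → S → ℝ
  measurable_T : Measurable fun q : D × S => T q.1.1.1 q.1.1.2 q.2
  /-- the one-stage cost `c(x, a, x')` -/
  c : ℝ → A → ℝ → ℝ≥0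
  measurable_c : Measurable fun q : D × ℝ => c q.1.1.1 q.1.1.2 q.2
  /-- the discount factor -/
  β : ℝ≥0
  β_pos : 0 < β

namespace Model

variable {A : Type u} {S : Type v} {Ω : Type w}
  [MeasurableSpace A] [MeasurableSpace S] [MeasurableSpace Ω]

/-- The set `D(x)` of actions admissible in state `x`. -/
def actions (M : Model A S Ω) (x : ℝ) : Set A := {a | (x, a) ∈ M.D}

/-- The realized one-stage cost `c(x, a, T(x, a, z))`. -/
def stepCost (M : Model A S Ω) (x : ℝ) (a : A) (z : S) : ℝ≥0 := M.c x a (M.T x a z)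

/-- The transition function of the extended model,
`(x, s, t, a, z) ↦ (T(x,a,z), s + t c(x,a,T(x,a,z)), β t)`. -/
def next (M : Model A S Ω) (y : ExtState) (a : A) (z : S) : ExtState :=
  (M.T y.1 a z, y.2.1 + y.2.2.1 * M.stepCost y.1 a z,
    ⟨M.β * y.2.2.1, mul_pos M.β_pos y.2.2.2⟩)

/-- Feasible histories `(x₀,s₀,t₀,a₀,x₁,s₁,t₁,a₁,…,xₙ,sₙ,tₙ)` of the extended model up to time
`n`, given by the extended states at times `0,…,n` and the actions at times `0,…,n-1`; it is
required that `a_k ∈ D(x_k)`. It carries the σ-algebra induced by the product σ-algebra. -/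
abbrev Hist (M : Model A S Ω) (n : ℕ) : Type u :=
  {h : (Fin (n + 1) → ExtState) × (Fin n → A) // ∀ k : Fin n, ((h.1 k.castSucc).1, h.2 k) ∈ M.D}

/-- The current extended state `(xₙ,sₙ,tₙ)` of a history. -/
def Hist.last {M : Model A S Ω} {n : ℕ} (h : M.Hist n) : ExtState := h.1.1 (Fin.last n)

/-- The history `(h, a, y)`, for an action `a` admissible at the end of `h`. -/
def Hist.append {M : Model A S Ω} {n : ℕ} (h : M.Hist n) (a : A)
    (ha : (Hist.last h).1 ∈ {x | (x, a) ∈ M.D}) (y : ExtState) : M.Hist (n + 1) :=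
  ⟨(Fin.snoc (α := fun _ => ExtState) h.1.1 y, Fin.snoc (α := fun _ => A) h.1.2 a), by
    intro k
    refine Fin.lastCases ?_ (fun i => ?_) k
    · simp only [Fin.snoc_castSucc, Fin.snoc_last]
      exact ha
    · simp only [Fin.snoc_castSucc]
      exact h.2 i⟩

/-- History-dependent decision rules at time `n`. -/
structure Rule (M : Model A S Ω) (n : ℕ) where
  toFun : M.Hist n → A
  measurable_toFun : Measurable toFun
  admissible : ∀ h, ((Hist.last h).1, toFun h) ∈ M.D

/-- History-dependent policies. An `N`-stage policy consists of the first `N` rules; the later ones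
play no role in an `N`-stage problem. -/
abbrev Policy (M : Model A S Ω) := (n : ℕ) → M.Rule n

/-- Markov decision rules `d : ExtState → A` of the extended model. -/
structure MarkovRule (M : Model A S Ω) where
  toFun : ExtState → A
  measurable_toFun : Measurable toFun
  admissible : ∀ y, (y.1, toFun y) ∈ M.D

/-- Markov policies `(d₀, d₁, …)`. -/
abbrev MarkovPolicy (M : Model A S Ω) := ℕ → M.MarkovRule

/-- A Markov policy regarded as a history-dependent policy. -/
def MarkovPolicy.toPolicy {M : Model A S Ω} (π : M.MarkovPolicy) : M.Policy := fun n =>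
  { toFun := fun h => (π n).toFun (Hist.last h)
    measurable_toFun := (π n).measurable_toFun.comp
      ((measurable_pi_apply (Fin.last n)).comp (measurable_fst.comp measurable_subtype_coe))
    admissible := fun h => (π n).admissible (Hist.last h) }

/-- The random history at time `n + j` under `π`, given that the history at time `n` is `h`. -/
def histFrom (M : Model A S Ω) (π : M.Policy) (n : ℕ) (h : M.Hist n) (ω : Ω) :
    (j : ℕ) → M.Hist (n + j)
  | 0 => h
  | j + 1 =>
    let h' := M.histFrom π n h ω j
    Hist.append h' ((π (n + j)).toFun h') ((π (n + j)).admissible h')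
      (M.next (Hist.last h') ((π (n + j)).toFun h') (M.Z (n + j) ω))

/-- The value at time `n`, given the history `h = (…,xₙ,sₙ,tₙ)`, of the policy `π` in the `N`-stage
problem (`n ≤ N`), i.e.
`E_{n h} [ g ( sₙ + tₙ ∑_{k=n}^{N-1} β^{k-n} c(X_k, d_k(H_k), X_{k+1}) ) ]`. Since the disturbances
are independent, conditioning on the history at time `n` means starting from it. -/
noncomputable def V_policy (M : Model A S Ω) (g : ℝ → ℝ) (N n : ℕ) (π : M.Policy) (h : M.Hist n) :
    ℝ≥0∞ :=
  ∫⁻ ω, ENNReal.ofReal (g (((Hist.last h).2.1 + (Hist.last h).2.2.1 *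
    ∑ j ∈ Finset.range (N - n), M.β ^ j *
      M.stepCost (Hist.last (M.histFrom π n h ω j)).1
        ((π (n + j)).toFun (M.histFrom π n h ω j)) (M.Z (n + j) ω) : ℝ≥0) : ℝ)) ∂M.P

/-- The value function `Vₙ(h) = inf_π V_{nπ}(h)` over all history-dependent policies. -/
noncomputable def V (M : Model A S Ω) (g : ℝ → ℝ) (N n : ℕ) (h : M.Hist n) : ℝ≥0∞ :=
  ⨅ π : M.Policy, M.V_policy g N n π h

/-- The random extended state at time `n + j` under the Markov policy `π`, given that the extended
state at time `n` is `y`. -/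
def stateFrom (M : Model A S Ω) (π : M.MarkovPolicy) (n : ℕ) (y : ExtState) (ω : Ω) : ℕ → ExtState
  | 0 => y
  | j + 1 => M.next (M.stateFrom π n y ω j)
      ((π (n + j)).toFun (M.stateFrom π n y ω j)) (M.Z (n + j) ω)

/-- The one-stage cost `c(X_{n+j}, d_{n+j}(X_{n+j},s_{n+j},t_{n+j}), X_{n+j+1})` under the Markov
policy `π`, given that the extended state at time `n` is `y`. -/
def costFrom (M : Model A S Ω) (π : M.MarkovPolicy) (n : ℕ) (y : ExtState) (ω : Ω) (j : ℕ) : ℝ≥0 :=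
  M.stepCost (M.stateFrom π n y ω j).1 ((π (n + j)).toFun (M.stateFrom π n y ω j)) (M.Z (n + j) ω)

/-- The value at time `n` in `y = (x,s,t)` of the Markov policy `π` in the `N`-stage problem
(`n ≤ N`): `E [ g ( s + t ∑_{k=n}^{N-1} β^{k-n} c(X_k, d_k(X_k,s_k,t_k), X_{k+1}) ) ]`. -/
noncomputable def J_policy (M : Model A S Ω) (g : ℝ → ℝ) (N n : ℕ) (π : M.MarkovPolicy)
    (y : ExtState) : ℝ≥0∞ :=
  ∫⁻ ω, ENNReal.ofReal (g ((y.2.1 + y.2.2.1 *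
    ∑ j ∈ Finset.range (N - n), M.β ^ j * M.costFrom π n y ω j : ℝ≥0) : ℝ)) ∂M.P

/-- The Markov value function at time `n` of the `N`-stage problem. In particular `J g N 0` is the
value function with `N` stages to go. -/
noncomputable def J (M : Model A S Ω) (g : ℝ → ℝ) (N n : ℕ) (y : ExtState) : ℝ≥0∞ :=
  ⨅ π : M.MarkovPolicy, M.J_policy g N n π y

open Classical in
/-- An increasing function `g`, non-negative on `[0,∞)`, as a function `[0,∞] → [0,∞]` with
`g(∞) = lim_{r → ∞} g(r)`. -/
noncomputable def extendTop (g : ℝ → ℝ) (r : ℝ≥0∞) : ℝ≥0∞ :=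
  if r = ⊤ then ⨆ q : ℝ≥0, ENNReal.ofReal (g q) else ENNReal.ofReal (g r.toReal)

/-- The value of the Markov policy `π` under an infinite planning horizon, started in `y = (x,s,t)`:
`E [ g ( s + t ∑_{k=0}^∞ β^k c(X_k, d_k(X_k,s_k,t_k), X_{k+1}) ) ]`. -/
noncomputable def Jinf_policy (M : Model A S Ω) (g : ℝ → ℝ) (π : M.MarkovPolicy) (y : ExtState) :
    ℝ≥0∞ :=
  ∫⁻ ω, extendTop g ((y.2.1 : ℝ≥0∞) + (y.2.2.1 : ℝ≥0∞) *
    ∑' j : ℕ, ((M.β ^ j * M.costFrom π 0 y ω j : ℝ≥0) : ℝ≥0∞)) ∂M.P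

/-- The infinite horizon value function. -/
noncomputable def Jinf (M : Model A S Ω) (g : ℝ → ℝ) (y : ExtState) : ℝ≥0∞ :=
  ⨅ π : M.MarkovPolicy, M.Jinf_policy g π y

/-- `L v(x,s,t,a) = E[v(T(x,a,Z), s + t c(x,a,T(x,a,Z)), β t)]`. -/
noncomputable def L (M : Model A S Ω) (v : ExtState → ℝ≥0∞) (y : ExtState) (a : A) : ℝ≥0∞ :=
  ∫⁻ ω, v (M.next y a (M.Z 0 ω)) ∂M.P

/-- The operator `𝒯_d v(x,s,t) = L v(x,s,t,d(x,s,t))` of a Markov decision rule. -/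
noncomputable def ruleOp (M : Model A S Ω) (d : M.MarkovRule) (v : ExtState → ℝ≥0∞) :
    ExtState → ℝ≥0∞ :=
  fun y => M.L v y (d.toFun y)

/-- The Bellman operator `𝒯 v(x,s,t) = inf_{a ∈ D(x)} L v(x,s,t,a)`. -/
noncomputable def bellman (M : Model A S Ω) (v : ExtState → ℝ≥0∞) : ExtState → ℝ≥0∞ :=
  fun y => ⨅ a ∈ M.actions y.1, M.L v y a

/-- The set `𝕄` of potential value functions: lower semicontinuous, increasing in `(s,t)`, and
`v(x,s,t) ≥ g(s)`. The value `+∞` is allowed. -/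
def potential (g : ℝ → ℝ) : Set (ExtState → ℝ≥0∞) :=
  {v | LowerSemicontinuous v ∧
    (∀ x, Monotone fun st : ℝ≥0 × Set.Ioi (0 : ℝ≥0) => v (x, st)) ∧
    ∀ (x : ℝ) (s : ℝ≥0) (t : Set.Ioi (0 : ℝ≥0)), ENNReal.ofReal (g s) ≤ v (x, s, t)}

/-- Compact sets of actions `D(x)`, with `x ↦ D(x)` upper semicontinuous and increasing; `T` upper
semicontinuous in `(x,a)` and increasing in `x`; `c(x,a,T(x,a,z))` lower semicontinuous in `(x,a)`
and decreasing in `x`. -/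
structure IsDecreasing [TopologicalSpace A] (M : Model A S Ω) : Prop where
  isCompact_actions : ∀ x, IsCompact (M.actions x)
  usc_actions : ∀ (x : ℝ) (xs : ℕ → ℝ) (as : ℕ → A), Tendsto xs atTop (𝓝 x) →
    (∀ k, as k ∈ M.actions (xs k)) → ∃ a ∈ M.actions x, MapClusterPt a atTop as
  monotone_actions : ∀ x y, x ≤ y → M.actions x ⊆ M.actions y
  usc_T : ∀ z, UpperSemicontinuousOn (fun p : ℝ × A => M.T p.1 p.2 z) M.D
  monotone_T : ∀ z a x y, (x, a) ∈ M.D → (y, a) ∈ M.D → x ≤ y → M.T x a z ≤ M.T y a z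
  lsc_cost : ∀ z, LowerSemicontinuousOn (fun p : ℝ × A => M.stepCost p.1 p.2 z) M.D
  antitone_cost : ∀ z a x y, (x, a) ∈ M.D → (y, a) ∈ M.D → x ≤ y →
    M.stepCost y a z ≤ M.stepCost x a z

/-- With the action space identified with a subset of a real vector space `E` through the injection
`ι`: the set `D` is convex, `T` is concave in `(x,a)` on `D`, and `(x,a) ↦ c(x,a,T(x,a,z))` is
convex on `D`. In the last two conditions `(x,a)` is the convex combination of `(x₁,a₁)` and
`(x₂,a₂)` with weights `p` and `q`. -/
structure IsConvexModel {E : Type*} [AddCommGroup E] [Module ℝ E] (M : Model A S Ω)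
    (ι : A → E) : Prop where
  injective : Function.Injective ι
  convex_D : Convex ℝ ((fun y : ℝ × A => (y.1, ι y.2)) '' M.D)
  concave_T : ∀ (z : S) (p q : ℝ) (x₁ x₂ x : ℝ) (a₁ a₂ a : A), 0 ≤ p → 0 ≤ q → p + q = 1 →
    (x₁, a₁) ∈ M.D → (x₂, a₂) ∈ M.D → (x, a) ∈ M.D →
    x = p * x₁ + q * x₂ → ι a = p • ι a₁ + q • ι a₂ →
    p * M.T x₁ a₁ z + q * M.T x₂ a₂ z ≤ M.T x a z
  convex_cost : ∀ (z : S) (p q : ℝ) (x₁ x₂ x : ℝ) (a₁ a₂ a : A), 0 ≤ p → 0 ≤ q → p + q = 1 →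
    (x₁, a₁) ∈ M.D → (x₂, a₂) ∈ M.D → (x, a) ∈ M.D →
    x = p * x₁ + q * x₂ → ι a = p • ι a₁ + q • ι a₂ →
    (M.stepCost x a z : ℝ) ≤ p * M.stepCost x₁ a₁ z + q * M.stepCost x₂ a₂ z

end Model

end MarkovDecision

/-! The extended state carries the accumulated cost, so `g` of the total cost is a terminal payoff
`terminal g` and dynamic programming applies. All arguments take place among regular functions:
lower semicontinuous, decreasing in `x`, increasing in `(s,t)`. This monotonicity turns the
one-sided semicontinuity of `T` and `c` into lower semicontinuity of `v ∘ next`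
(`lowerSemicontinuousOn_comp_next`). Fatou then gives joint lower semicontinuity of `L v`.
Compactness and upper semicontinuity of `D(·)` give attained minima and regularity of `bellman v`,
and `exists_measurable_argmin` makes the minimizers measurable.

Finite horizon: by independence of the disturbances, the mean of `v` after one step is the mean of
`L v` before it. Along any policy, the mean of the iterate with the remaining number of stages
therefore cannot decrease, and it is constant along minimizers. Hence `V` and `J` are both given by
`valueIter`.

Infinite horizon: costs are nonnegative, so the iterates increase and, by monotone convergence,
policy values are suprema of finite-horizon values. Compactness lets `bellman` commute with the
supremum (`bellman_iSup`), so the limit is a fixed point. It bounds every policy value from below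
and is attained by a stationary minimizer. Monotonicity of `bellman` makes it smallest.

Convexity survives `bellman` because convex combinations of minimizers are admissible, and it passes
to the supremum. -/

/-! ### Measurable selection of minimizers -/

/-- The set of minimizers of `f` on `K`. -/
def argminOn {A : Type*} (f : A → ℝ≥0∞) (K : Set A) : Set A := {a ∈ K | ∀ b ∈ K, f a ≤ f b}

theorem argminOn_subset {A : Type*} (f : A → ℝ≥0∞) (K : Set A) : argminOn f K ⊆ K :=
  fun _ h => h.1

theorem argminOn_nonempty {A : Type*} [TopologicalSpace A] {f : A → ℝ≥0∞} {K : Set A}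
    (hK : IsCompact K) (hne : K.Nonempty) (hf : LowerSemicontinuousOn f K) :
    (argminOn f K).Nonempty := by
  obtain ⟨a, ha, hmin⟩ := hf.exists_isMinOn hne hK
  exact ⟨a, ha, fun b hb => hmin hb⟩

theorem isCompact_argminOn {A : Type*} [TopologicalSpace A] {f : A → ℝ≥0∞} {K : Set A}
    (hK : IsCompact K) (hne : K.Nonempty) (hf : LowerSemicontinuousOn f K) :
    IsCompact (argminOn f K) := by
  obtain ⟨a, ha, hmin⟩ := argminOn_nonempty hK hne hf
  have : argminOn f K = K ∩ f ⁻¹' Set.Iic (f a) := by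
    ext b
    exact ⟨fun hb => ⟨hb.1, hb.2 a ha⟩, fun hb => ⟨hb.1, fun c hc => le_trans hb.2 (hmin c hc)⟩⟩
  rw [this]
  exact hf.isCompact_inter_preimage_Iic hK _

/-- The minimizers meet `F` iff `K y ∩ F` is nonempty and the minimum over it does not exceed the
minimum over `K y`. The comparison is tested at rational levels; the level `⊤` encodes nonemptiness.
-/
theorem measurableSet_argminOn_inter_nonempty {Y A : Type*} [MeasurableSpace Y]
    [TopologicalSpace A] {f : Y → A → ℝ≥0∞} {K : Y → Set A}
    (hK : ∀ y, IsCompact (K y)) (hne : ∀ y, (K y).Nonempty)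
    (hf : ∀ y, LowerSemicontinuousOn (f y) (K y))
    (hmeas : ∀ F : Set A, IsClosed F → ∀ r : ℝ≥0∞, MeasurableSet {y | ∃ a ∈ K y ∩ F, f y a ≤ r})
    {F : Set A} (hF : IsClosed F) :
    MeasurableSet {y | (argminOn (f y) (K y) ∩ F).Nonempty} := by
  have key : {y | (argminOn (f y) (K y) ∩ F).Nonempty} =
      {y | ∃ a ∈ K y ∩ F, f y a ≤ ⊤} ∩ ⋂ q : ℚ,
        ({y | ∃ a ∈ K y ∩ Set.univ, f y a ≤ (Real.toNNReal q : ℝ≥0∞)}ᶜ ∪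
          {y | ∃ a ∈ K y ∩ F, f y a ≤ (Real.toNNReal q : ℝ≥0∞)}) := by
    ext y
    simp only [Set.mem_inter_iff, Set.mem_iInter, Set.mem_union, Set.mem_compl_iff,
      Set.mem_ofPred_eq, le_top, and_true]
    constructor
    · rintro ⟨a, ha, haF⟩
      refine ⟨⟨a, ha.1, haF⟩, fun q => ?_⟩
      by_cases h : ∃ b, (b ∈ K y ∧ b ∈ Set.univ) ∧ f y b ≤ (Real.toNNReal q : ℝ≥0∞)
      · obtain ⟨b, hb, hbq⟩ := h
        exact Or.inr ⟨a, ⟨ha.1, haF⟩, (ha.2 b hb.1).trans hbq⟩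
      · exact Or.inl h
    · rintro ⟨⟨a, haK, haF⟩, hq⟩
      obtain ⟨a₀, ha₀, hmin₀⟩ := argminOn_nonempty ((hK y).inter_right hF) ⟨a, haK, haF⟩
        ((hf y).mono Set.inter_subset_left)
      obtain ⟨b₀, hb₀, hminb⟩ := argminOn_nonempty (hK y) (hne y) (hf y)
      refine ⟨a₀, ⟨ha₀.1, fun b hb => ?_⟩, ha₀.2⟩
      refine le_trans ?_ (hminb b hb)
      by_contra hlt
      obtain ⟨q, -, hq1, hq2⟩ := ENNReal.lt_iff_exists_rat_btwn.1 (not_le.1 hlt)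
      rcases hq q with h | ⟨a', ha', ha'q⟩
      · exact h ⟨b₀, ⟨hb₀, trivial⟩, hq1.le⟩
      · exact absurd (lt_of_le_of_lt ha'q hq2) (not_lt.2 (hmin₀ a' ha'))
  rw [key]
  exact (hmeas F hF ⊤).inter (MeasurableSet.iInter fun q =>
    (hmeas _ isClosed_univ _).compl.union (hmeas F hF _))

/-- Iterated minimization: first of `f`, then of `φ 0`, `φ 1`, …. -/
def lexArgmin {A : Type*} (f : A → ℝ≥0∞) (φ : ℕ → A → ℝ≥0∞) (K : Set A) : ℕ → Set A
  | 0 => argminOn f K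
  | k + 1 => argminOn (φ k) (lexArgmin f φ K k)

/-- Ties are broken by successively minimizing the distances to a dense sequence. The nested compact
sets of minimizers shrink to a single point, which is the selection. -/
theorem exists_measurable_argmin {Y A : Type*} [MeasurableSpace Y]
    [TopologicalSpace A] [TopologicalSpace.MetrizableSpace A] [SecondCountableTopology A]
    [MeasurableSpace A] [BorelSpace A] {f : Y → A → ℝ≥0∞} {K : Y → Set A}
    (hK : ∀ y, IsCompact (K y)) (hne : ∀ y, (K y).Nonempty)
    (hf : ∀ y, LowerSemicontinuousOn (f y) (K y))
    (hmeas : ∀ F : Set A, IsClosed F → ∀ r : ℝ≥0∞,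
      MeasurableSet {y | ∃ a ∈ K y ∩ F, f y a ≤ r}) :
    ∃ d : Y → A, Measurable d ∧ ∀ y, d y ∈ K y ∧ ∀ a ∈ K y, f y (d y) ≤ f y a := by
  let := TopologicalSpace.metrizableSpaceMetric A
  -- `denseSeq` needs a nonempty space; if `A` is empty, so is `Y`.
  rcases isEmpty_or_nonempty A with hA | hA
  · have : IsEmpty Y := ⟨fun y => hA.elim (hne y).some⟩
    exact ⟨fun y => this.elim y, measurable_of_empty _, fun y => this.elim y⟩
  let φ : ℕ → A → ℝ≥0∞ := fun k a => edist a (TopologicalSpace.denseSeq A k)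
  have hφ : ∀ k, Continuous (φ k) := fun k => continuous_id.edist continuous_const
  let G : ℕ → Y → Set A := fun k y => lexArgmin (f y) φ (K y) k
  have hG : ∀ k, (∀ y, IsCompact (G k y)) ∧ (∀ y, (G k y).Nonempty) ∧
      ∀ F : Set A, IsClosed F → MeasurableSet {y | (G k y ∩ F).Nonempty} := by
    intro k
    induction k with
    | zero =>
      exact ⟨fun y => isCompact_argminOn (hK y) (hne y) (hf y),
        fun y => argminOn_nonempty (hK y) (hne y) (hf y),
        fun F hF => measurableSet_argminOn_inter_nonempty hK hne hf hmeas hF⟩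
    | succ k ih =>
      obtain ⟨hc, hn, hm⟩ := ih
      have hl : ∀ y, LowerSemicontinuousOn (φ k) (G k y) :=
        fun y => (hφ k).lowerSemicontinuous.lowerSemicontinuousOn _
      refine ⟨fun y => isCompact_argminOn (hc y) (hn y) (hl y),
        fun y => argminOn_nonempty (hc y) (hn y) (hl y), fun F hF =>
        measurableSet_argminOn_inter_nonempty (f := fun _ => φ k) hc hn hl (fun F hF r => ?_) hF⟩
      have : {y | ∃ a ∈ G k y ∩ F, φ k a ≤ r} =
          {y | (G k y ∩ (F ∩ φ k ⁻¹' Set.Iic r)).Nonempty} := by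
        ext y
        exact ⟨fun ⟨a, ha, har⟩ => ⟨a, ha.1, ha.2, har⟩,
          fun ⟨a, ha, haF, har⟩ => ⟨a, ⟨ha, haF⟩, har⟩⟩
      rw [this]
      exact hm _ (hF.inter (isClosed_Iic.preimage (hφ k)))
  have hanti : ∀ y k, G (k + 1) y ⊆ G k y := fun y k => argminOn_subset _ _
  have hinter : ∀ (F : Set A), IsClosed F → ∀ y, (∀ k, (G k y ∩ F).Nonempty) →
      (⋂ k, G k y ∩ F).Nonempty := fun F hF y h =>
    IsCompact.nonempty_iInter_of_sequence_nonempty_isCompact_isClosed _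
      (fun k => Set.inter_subset_inter_left _ (hanti y k)) h (((hG 0).1 y).inter_right hF)
      (fun k => ((hG k).1 y).isClosed.inter hF)
  have hex : ∀ y, ∃ a, ∀ k, a ∈ G k y := fun y => by
    obtain ⟨a, ha⟩ := hinter Set.univ isClosed_univ y fun k => by
      simpa using (hG k).2.1 y
    exact ⟨a, fun k => (Set.mem_iInter.1 ha k).1⟩
  -- Points surviving every stage have equal distances to a dense set, hence to all points, in
  -- particular to each other.
  have huniq : ∀ y a b, (∀ k, a ∈ G k y) → (∀ k, b ∈ G k y) → a = b := by
    intro y a b ha hb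
    have heq : ∀ k, edist a (TopologicalSpace.denseSeq A k) =
        edist b (TopologicalSpace.denseSeq A k) := fun k =>
      le_antisymm ((ha (k + 1)).2 b (hb k)) ((hb (k + 1)).2 a (ha k))
    have hcl : IsClosed {x : A | edist a x = edist b x} :=
      isClosed_eq (continuous_const.edist continuous_id) (continuous_const.edist continuous_id)
    have hall : ∀ x : A, edist a x = edist b x := fun x =>
      (hcl.closure_subset_iff.2 (Set.range_subset_iff.2 heq))
        (TopologicalSpace.denseRange_denseSeq A x)
    have := hall a
    rw [edist_self] at this
    exact (edist_eq_zero.1 this.symm).symm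
  choose d hd using hex
  refine ⟨d, measurable_of_isClosed fun F hF => ?_, fun y => hd y 0⟩
  -- If every stage meets `F`, compactness gives a common point in `F`, which by uniqueness is `d
  -- y`.
  have : d ⁻¹' F = ⋂ k, {y | (G k y ∩ F).Nonempty} := by
    ext y
    simp only [Set.mem_preimage, Set.mem_iInter, Set.mem_ofPred_eq]
    refine ⟨fun h k => ⟨d y, hd y k, h⟩, fun h => ?_⟩
    obtain ⟨a, ha⟩ := hinter F hF y h
    have ha' := fun k => Set.mem_iInter.1 ha k
    rw [huniq y (d y) a (hd y) fun k => (ha' k).1]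
    exact (ha' 0).2
  rw [this]
  exact MeasurableSet.iInter fun k => (hG k).2.2 F hF

/-! ### Regular functions and the Bellman operator -/

namespace MarkovDecision

/-- Lower semicontinuous functions on the extended state space that are decreasing in `x` and
increasing in `(s,t)`. -/
structure IsRegular (v : ExtState → ℝ≥0∞) : Prop where
  lsc : LowerSemicontinuous v
  antitone : ∀ st, Antitone fun x : ℝ => v (x, st)
  monotone : ∀ x, Monotone fun st : ℝ≥0 × Set.Ioi (0 : ℝ≥0) => v (x, st)

theorem IsRegular.le {v : ExtState → ℝ≥0∞} (hv : IsRegular v) {y y' : ExtState}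
    (h1 : y'.1 ≤ y.1) (h2 : y.2 ≤ y'.2) : v y ≤ v y' :=
  (hv.antitone y.2 h1).trans (hv.monotone y'.1 h2)

theorem IsRegular.measurable {v : ExtState → ℝ≥0∞} (hv : IsRegular v) : Measurable v :=
  hv.lsc.measurable

/-- Truncating at the limit value turns one-sided control into genuine convergence of a majorant;
the next lemma gives the dual minorant. -/
theorem tendsto_max_of_upperSemicontinuousWithinAt {X α : Type*} [TopologicalSpace X]
    [LinearOrder α] [TopologicalSpace α] [OrderTopology α] {f : X → α} {s : Set X} {x : X}
    (hf : UpperSemicontinuousWithinAt f s x) :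
    Tendsto (fun y => max (f y) (f x)) (𝓝[s] x) (𝓝 (f x)) := by
  refine tendsto_order.2 ⟨fun a ha => Eventually.of_forall fun y => lt_max_of_lt_right ha,
    fun a ha => ?_⟩
  filter_upwards [hf a ha] with y hy using max_lt hy ha

theorem tendsto_min_of_lowerSemicontinuousWithinAt {X α : Type*} [TopologicalSpace X]
    [LinearOrder α] [TopologicalSpace α] [OrderTopology α] {f : X → α} {s : Set X} {x : X}
    (hf : LowerSemicontinuousWithinAt f s x) :
    Tendsto (fun y => min (f y) (f x)) (𝓝[s] x) (𝓝 (f x)) := by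
  refine tendsto_order.2 ⟨fun a ha => ?_,
    fun a ha => Eventually.of_forall fun y => min_lt_of_right_lt ha⟩
  filter_upwards [hf a ha] with y hy using lt_min hy ha

namespace Model

variable {A S Ω : Type*} [MeasurableSpace A] [MeasurableSpace S] [MeasurableSpace Ω]

/-- The pairs of extended states and actions that are admissible there. -/
def admissible (M : Model A S Ω) : Set (ExtState × A) := {p | (p.1.1, p.2) ∈ M.D}

theorem measurable_next (M : Model A S Ω) :
    Measurable fun q : M.admissible × S => M.next q.1.1.1 q.1.1.2 q.2 := by
  have hD : Measurable fun q : M.admissible × S =>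
      ((⟨(q.1.1.1.1, q.1.1.2), q.1.2⟩ : M.D), q.2) := by
    refine Measurable.prodMk (Measurable.subtype_mk ?_) measurable_snd
    fun_prop
  have hT := M.measurable_T.comp hD
  have hc : Measurable fun q : M.admissible × S => M.stepCost q.1.1.1.1 q.1.1.2 q.2 :=
    M.measurable_c.comp ((measurable_fst.comp hD).prodMk hT)
  unfold next
  refine hT.prodMk (Measurable.prodMk ?_ (Measurable.subtype_mk ?_))
  · fun_prop
  · fun_prop

theorem measurable_next_Z (M : Model A S Ω) {y : ExtState} {a : A} (h : (y, a) ∈ M.admissible)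
    (n : ℕ) : Measurable fun ω => M.next y a (M.Z n ω) :=
  M.measurable_next.comp (g := fun q : M.admissible × S => M.next q.1.1.1 q.1.1.2 q.2)
    (f := fun ω => ((⟨(y, a), h⟩ : M.admissible), M.Z n ω))
    (measurable_const.prodMk (M.measurable_Z n))

theorem actions_nonempty (M : Model A S Ω) (x : ℝ) : (M.actions x).Nonempty := by
  obtain ⟨f, -, hf⟩ := M.exists_graph_subset_D
  exact ⟨f x, hf x⟩

theorem L_mono (M : Model A S Ω) {v w : ExtState → ℝ≥0∞} (h : v ≤ w) (y : ExtState) (a : A) :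
    M.L v y a ≤ M.L w y a := lintegral_mono fun _ => h _

theorem bellman_mono (M : Model A S Ω) : Monotone M.bellman :=
  fun _ _ h y => iInf₂_mono fun a _ => M.L_mono h y a

theorem bellman_le (M : Model A S Ω) (v : ExtState → ℝ≥0∞) {y : ExtState} {a : A}
    (h : a ∈ M.actions y.1) : M.bellman v y ≤ M.L v y a := iInf₂_le a h

section Topological

variable [TopologicalSpace A] {M : Model A S Ω}

/-- Replace `T` by its maximum, and the cost by its minimum, with the value at the base point. The
modified successor converges, so lower semicontinuity of `v` applies there; by monotonicity `v` is
no smaller at the true successor. -/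
theorem lowerSemicontinuousOn_comp_next (hM : M.IsDecreasing) {v : ExtState → ℝ≥0∞}
    (hv : IsRegular v) (z : S) :
    LowerSemicontinuousOn (fun p : ExtState × A => v (M.next p.1 p.2 z)) M.admissible := by
  rintro ⟨y₀, a₀⟩ h₀
  have hproj : Tendsto (fun p : ExtState × A => (p.1.1, p.2)) (𝓝[M.admissible] (y₀, a₀))
      (𝓝[M.D] (y₀.1, a₀)) := by
    refine tendsto_nhdsWithin_iff.2 ⟨?_, eventually_mem_nhdsWithin⟩
    exact (Continuous.tendsto (by fun_prop) (y₀, a₀)).mono_left nhdsWithin_le_nhds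
  have hT := (tendsto_max_of_upperSemicontinuousWithinAt (hM.usc_T z _ h₀)).comp hproj
  have hc := (tendsto_min_of_lowerSemicontinuousWithinAt (hM.lsc_cost z _ h₀)).comp hproj
  have hfst : Tendsto (fun p : ExtState × A => p.1) (𝓝[M.admissible] (y₀, a₀)) (𝓝 y₀) :=
    (Continuous.tendsto continuous_fst (y₀, a₀)).mono_left nhdsWithin_le_nhds
  have hs : Tendsto (fun p : ExtState × A => p.1.2.1) (𝓝[M.admissible] (y₀, a₀)) (𝓝 y₀.2.1) :=
    ((Continuous.tendsto (by fun_prop) y₀ : Tendsto (fun y : ExtState => y.2.1) _ _)).comp hfst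
  have ht : Tendsto (fun p : ExtState × A => p.1.2.2.1) (𝓝[M.admissible] (y₀, a₀))
      (𝓝 y₀.2.2.1) :=
    ((Continuous.tendsto (by fun_prop) y₀ : Tendsto (fun y : ExtState => y.2.2.1) _ _)).comp hfst
  have ht' : Tendsto (fun p : ExtState × A =>
      (⟨M.β * p.1.2.2.1, mul_pos M.β_pos p.1.2.2.2⟩ : Set.Ioi (0 : ℝ≥0)))
      (𝓝[M.admissible] (y₀, a₀)) (𝓝 ⟨M.β * y₀.2.2.1, mul_pos M.β_pos y₀.2.2.2⟩) :=
    tendsto_subtype_rng.2 (ht.const_mul _)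
  have hall := hT.prodMk_nhds ((hs.add (ht.mul hc)).prodMk_nhds ht')
  intro r hr
  filter_upwards [hall.eventually (hv.lsc _ r hr)] with p hp
  refine hp.trans_le (hv.le (le_max_left _ _) ⟨?_, le_rfl⟩)
  exact add_le_add le_rfl (mul_le_mul_right (min_le_left _ _) _)

/-- Fatou's lemma along a sequence that would violate lower semicontinuity; first countability
supplies the sequence. -/
theorem lowerSemicontinuousOn_L [FirstCountableTopology A] (hM : M.IsDecreasing)
    {v : ExtState → ℝ≥0∞} (hv : IsRegular v) :
    LowerSemicontinuousOn (fun p : ExtState × A => M.L v p.1 p.2) M.admissible := by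
  rintro p₀ h₀ r hr
  by_contra hcon
  have hfreq : ∃ᶠ p in 𝓝[M.admissible] p₀, M.L v p.1 p.2 ≤ r ∧ p ∈ M.admissible :=
    ((not_eventually.1 hcon).mono fun p hp => not_lt.1 hp).and_eventually
      eventually_mem_nhdsWithin
  obtain ⟨p, hp, hpr⟩ := exists_seq_forall_of_frequently hfreq
  refine absurd hr (not_lt.2 ?_)
  calc M.L v p₀.1 p₀.2
      ≤ ∫⁻ ω, liminf (fun k => v (M.next (p k).1 (p k).2 (M.Z 0 ω))) atTop ∂M.P := by
        refine lintegral_mono fun ω => ?_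
        refine le_of_forall_lt fun b hb => ?_
        obtain ⟨c, hbc, hc⟩ := exists_between hb
        refine hbc.trans_le (le_liminf_of_le (by isBoundedDefault) ?_)
        filter_upwards [hp.eventually
          (lowerSemicontinuousOn_comp_next hM hv (M.Z 0 ω) p₀ h₀ c hc)] with k hk using hk.le
    _ ≤ liminf (fun k => M.L v (p k).1 (p k).2) atTop :=
        lintegral_liminf_le fun k => hv.measurable.comp (M.measurable_next_Z (hpr k).2 0)
    _ ≤ r := liminf_le_of_le (by isBoundedDefault) fun b hb => by
        obtain ⟨k, hk⟩ := hb.exists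
        exact hk.trans (hpr k).1

theorem lowerSemicontinuousOn_L_actions [FirstCountableTopology A] (hM : M.IsDecreasing)
    {v : ExtState → ℝ≥0∞} (hv : IsRegular v) (y : ExtState) :
    LowerSemicontinuousOn (M.L v y) (M.actions y.1) := by
  intro a ha r hr
  have : Tendsto (fun a : A => (y, a)) (𝓝[M.actions y.1] a) (𝓝[M.admissible] (y, a)) :=
    tendsto_nhdsWithin_iff.2 ⟨(Continuous.tendsto (by fun_prop) a).mono_left nhdsWithin_le_nhds,
      eventually_mem_nhdsWithin⟩
  exact this.eventually (lowerSemicontinuousOn_L hM hv (y, a) ha r hr)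

theorem exists_L_eq_bellman [FirstCountableTopology A] (hM : M.IsDecreasing)
    {v : ExtState → ℝ≥0∞} (hv : IsRegular v) (y : ExtState) :
    ∃ a ∈ M.actions y.1, M.L v y a = M.bellman v y := by
  obtain ⟨a, ha, hmin⟩ := argminOn_nonempty (hM.isCompact_actions y.1) (M.actions_nonempty y.1)
    (lowerSemicontinuousOn_L_actions hM hv y)
  exact ⟨a, ha, le_antisymm (le_iInf₂ hmin) (M.bellman_le v ha)⟩

/-- Upper semicontinuity of `D(·)` yields an accumulation point of the actions, and joint lower
semicontinuity of `L v` keeps the bound. The case `F = univ` gives lower semicontinuity of `bellman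
v`; general `F` feeds the measurable selection. -/
theorem isClosed_exists_L_le [FirstCountableTopology A] (hM : M.IsDecreasing)
    {v : ExtState → ℝ≥0∞} (hv : IsRegular v) {F : Set A} (hF : IsClosed F) (r : ℝ≥0∞) :
    IsClosed {y : ExtState | ∃ a ∈ M.actions y.1 ∩ F, M.L v y a ≤ r} := by
  refine IsSeqClosed.isClosed fun ys y hys hlim => ?_
  choose as has hr using hys
  obtain ⟨a, ha, hcl⟩ := hM.usc_actions y.1 (fun k => (ys k).1) as
    ((continuous_fst.tendsto y).comp hlim) (fun k => (has k).1)
  obtain ⟨ψ, hψ, hψa⟩ := hcl.tendsto_subseq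
  refine ⟨a, ⟨ha, hF.mem_of_tendsto hψa (Eventually.of_forall fun k => (has _).2)⟩, ?_⟩
  by_contra hlt
  have hp : Tendsto (fun k => (ys (ψ k), as (ψ k))) atTop (𝓝[M.admissible] (y, a)) :=
    tendsto_nhdsWithin_iff.2 ⟨(hlim.comp hψ.tendsto_atTop).prodMk_nhds hψa,
      Eventually.of_forall fun k => (has (ψ k)).1⟩
  obtain ⟨k, hk⟩ := (hp.eventually (lowerSemicontinuousOn_L hM hv (y, a) ha r
    (not_le.1 hlt))).exists
  exact absurd (hr (ψ k)) (not_le.2 hk)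

theorem isRegular_bellman [FirstCountableTopology A] (hM : M.IsDecreasing)
    {v : ExtState → ℝ≥0∞} (hv : IsRegular v) : IsRegular (M.bellman v) where
  lsc := by
    refine lowerSemicontinuous_iff_isClosed_preimage.2 fun r => ?_
    convert isClosed_exists_L_le hM hv isClosed_univ r using 1
    ext y
    constructor
    · intro h
      obtain ⟨a, ha, heq⟩ := exists_L_eq_bellman hM hv y
      exact ⟨a, ⟨ha, trivial⟩, heq.trans_le h⟩
    · rintro ⟨a, ha, h⟩
      exact (M.bellman_le v ha.1).trans h
  antitone st x x' hx := by
    refine le_iInf₂ fun a ha => ?_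
    -- An action for the smaller state stays admissible at the larger one, where it costs less and
    -- leads to a larger successor.
    have ha' : a ∈ M.actions x' := hM.monotone_actions x x' hx ha
    refine (M.bellman_le v (y := (x', st)) ha').trans (lintegral_mono fun ω => hv.le ?_ ⟨?_, le_rfl⟩)
    · exact hM.monotone_T _ a x x' ha ha' hx
    · exact add_le_add le_rfl (mul_le_mul_right (hM.antitone_cost _ a x x' ha ha' hx) _)
  monotone x st st' h := by
    refine le_iInf₂ fun a ha => (M.bellman_le v (y := (x, st)) ha).trans
      (lintegral_mono fun ω => hv.le le_rfl ⟨?_, ?_⟩)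
    · exact add_le_add h.1 (mul_le_mul_left (show st.2.1 ≤ st'.2.1 from h.2) _)
    · exact mul_le_mul_right (show st.2.1 ≤ st'.2.1 from h.2) M.β

theorem exists_markovRule_ruleOp_eq [TopologicalSpace.MetrizableSpace A]
    [SecondCountableTopology A] [BorelSpace A] (hM : M.IsDecreasing)
    {v : ExtState → ℝ≥0∞} (hv : IsRegular v) : ∃ d : M.MarkovRule, M.ruleOp d v = M.bellman v := by
  obtain ⟨d, hd, hmin⟩ := exists_measurable_argmin (f := M.L v)
    (K := fun y : ExtState => M.actions y.1) (fun y => hM.isCompact_actions y.1)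
    (fun y => M.actions_nonempty y.1) (lowerSemicontinuousOn_L_actions hM hv)
    (fun F hF r => (isClosed_exists_L_le hM hv hF r).measurableSet)
  exact ⟨⟨d, hd, fun y => (hmin y).1⟩, funext fun y =>
    le_antisymm (le_iInf₂ (hmin y).2) (M.bellman_le v (hmin y).1)⟩

/-- The actions with `L (v k) y ≤ r` form decreasing nonempty compact sets. A common action
satisfies the bound for the supremum by monotone convergence. -/
theorem bellman_iSup [FirstCountableTopology A] (hM : M.IsDecreasing)
    [T2Space A]
    {v : ℕ → ExtState → ℝ≥0∞} (hmono : Monotone v) (hv : ∀ k, IsRegular (v k)) :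
    M.bellman (fun y => ⨆ k, v k y) = fun y => ⨆ k, M.bellman (v k) y := by
  funext y
  refine le_antisymm ?_ (iSup_le fun k =>
    M.bellman_mono (fun y => le_iSup (fun k => v k y) k) y)
  set r := ⨆ k, M.bellman (v k) y
  let G : ℕ → Set A := fun k => M.actions y.1 ∩ M.L (v k) y ⁻¹' Set.Iic r
  have hG : ∀ k, IsCompact (G k) := fun k =>
    (lowerSemicontinuousOn_L_actions hM (hv k) y).isCompact_inter_preimage_Iic
      (hM.isCompact_actions y.1) r
  obtain ⟨a, ha⟩ := IsCompact.nonempty_iInter_of_sequence_nonempty_isCompact_isClosed G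
    (fun k a ha => ⟨ha.1, le_trans (M.L_mono (hmono k.le_succ) y a) ha.2⟩)
    (fun k => by
      obtain ⟨a, ha, h⟩ := exists_L_eq_bellman hM (hv k) y
      exact ⟨a, ha, h.trans_le (le_iSup (fun k => M.bellman (v k) y) k)⟩)
    (hG 0) (fun k => (hG k).isClosed)
  have ha' : ∀ k, a ∈ G k := Set.mem_iInter.1 ha
  refine (M.bellman_le _ (ha' 0).1).trans ?_
  have : M.L (fun y => ⨆ k, v k y) y a = ⨆ k, M.L (v k) y a :=
    lintegral_iSup (fun k => (hv k).measurable.comp (M.measurable_next_Z (ha' 0).1 0))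
      fun i j hij ω => hmono hij _
  rw [this]
  exact iSup_le fun k => (ha' k).2

theorem isRegular_iSup {v : ℕ → ExtState → ℝ≥0∞} (hv : ∀ k, IsRegular (v k)) :
    IsRegular fun y => ⨆ k, v k y where
  lsc := lowerSemicontinuous_iSup fun k => (hv k).lsc
  antitone st _ _ h := iSup_mono fun k => (hv k).antitone st h
  monotone x _ _ h := iSup_mono fun k => (hv k).monotone x h

end Topological

end Model

end MarkovDecision

/-! ### Histories, one-step conditioning and the finite horizon -/

namespace MarkovDecision

namespace Model

variable {A S Ω : Type*} [MeasurableSpace A] [MeasurableSpace S] [MeasurableSpace Ω]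
  {M : Model A S Ω}

theorem measurable_last {n : ℕ} : Measurable (Hist.last : M.Hist n → ExtState) :=
  (measurable_pi_apply (Fin.last n)).comp (measurable_fst.comp measurable_subtype_coe)

theorem Hist.last_append {n : ℕ} (h : M.Hist n) (a : A)
    (ha : (Hist.last h).1 ∈ {x | (x, a) ∈ M.D}) (y : ExtState) :
    Hist.last (Hist.append h a ha y) = y := by
  simp [Hist.last, Hist.append]

theorem measurable_next_rule {Ω' : Type*} [MeasurableSpace Ω'] {n : ℕ} {H : Ω' → M.Hist n}
    (hH : Measurable H) (d : M.Rule n) {z : Ω' → S} (hz : Measurable z) :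
    Measurable fun ω => M.next (Hist.last (H ω)) (d.toFun (H ω)) (z ω) :=
  M.measurable_next.comp (g := fun q : M.admissible × S => M.next q.1.1.1 q.1.1.2 q.2)
    (f := fun ω => ((⟨(Hist.last (H ω), d.toFun (H ω)), d.admissible (H ω)⟩ : M.admissible), z ω))
    ((Measurable.subtype_mk ((measurable_last.comp hH).prodMk
      (d.measurable_toFun.comp hH))).prodMk hz)

theorem measurable_append_rule {Ω' : Type*} [MeasurableSpace Ω'] {n : ℕ} {H : Ω' → M.Hist n}
    (hH : Measurable H) (d : M.Rule n) {z : Ω' → S} (hz : Measurable z) :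
    Measurable fun ω => Hist.append (H ω) (d.toFun (H ω)) (d.admissible (H ω))
      (M.next (Hist.last (H ω)) (d.toFun (H ω)) (z ω)) := by
  refine Measurable.subtype_mk (Measurable.prodMk ?_ ?_)
  · refine measurable_pi_lambda _ fun i => ?_
    refine Fin.lastCases ?_ (fun i => ?_) i
    · simpa only [Fin.snoc_last] using measurable_next_rule hH d hz
    · simp only [Fin.snoc_castSucc]
      exact (measurable_pi_apply i).comp (measurable_fst.comp (measurable_subtype_coe.comp hH))
  · refine measurable_pi_lambda _ fun i => ?_
    refine Fin.lastCases ?_ (fun i => ?_) i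
    · simp only [Fin.snoc_last]
      exact d.measurable_toFun.comp hH
    · simp only [Fin.snoc_castSucc]
      exact (measurable_pi_apply i).comp (measurable_snd.comp (measurable_subtype_coe.comp hH))

/-- The auxiliary space `Ω'` allows `Ω` with the smaller σ-algebra of past disturbances, as
independence requires. -/
theorem measurable_histFrom_comp {Ω' : Type*} [MeasurableSpace Ω'] (φ : Ω' → Ω) (π : M.Policy)
    (n : ℕ) (h : M.Hist n) (j : ℕ) (hφ : ∀ i < j, Measurable fun ω => M.Z (n + i) (φ ω)) :
    Measurable fun ω => M.histFrom π n h (φ ω) j := by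
  induction j with
  | zero => exact measurable_const
  | succ j ih =>
    exact measurable_append_rule (ih fun i hi => hφ i (hi.trans j.lt_succ_self)) (π (n + j))
      (hφ j j.lt_succ_self)

theorem measurable_histFrom (π : M.Policy) (n : ℕ) (h : M.Hist n) (j : ℕ) :
    Measurable fun ω => M.histFrom π n h ω j :=
  measurable_histFrom_comp id π n h j fun _ _ => M.measurable_Z _

/-- The history is a function of disturbances with index below `n + j` only. -/
theorem indepFun_histFrom (π : M.Policy) (n : ℕ) (h : M.Hist n) (j : ℕ) :
    IndepFun (fun ω => M.histFrom π n h ω j) (M.Z (n + j)) M.P := by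
  have hind : Indep (⨆ i ∈ Set.Iio (n + j), MeasurableSpace.comap (M.Z i) inferInstance)
      (⨆ i ∈ ({n + j} : Set ℕ), MeasurableSpace.comap (M.Z i) inferInstance) M.P :=
    indep_iSup_of_disjoint (fun i => (M.measurable_Z i).comap_le) M.indep_Z
      (Set.disjoint_singleton_right.2 (lt_irrefl (n + j)))
  rw [iSup_singleton] at hind
  refine indep_of_indep_of_le_left hind (Measurable.comap_le ?_)
  refine @measurable_histFrom_comp _ _ _ _ _ _ M _
    (⨆ i ∈ Set.Iio (n + j), MeasurableSpace.comap (M.Z i) inferInstance) id π n h j fun i hi => ?_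
  refine measurable_iff_comap_le.2 ?_
  exact le_iSup₂_of_le (n + i) (Nat.add_lt_add_left hi n) le_rfl

/-- Independence factorizes the joint law, Tonelli integrates out the disturbance, and equality of
laws replaces `Z k` by the `Z 0` of `L`. -/
theorem lintegral_next_rule {n : ℕ} {H : Ω → M.Hist n} (hH : Measurable H) {k : ℕ}
    (hind : IndepFun H (M.Z k) M.P) (d : M.Rule n) {v : ExtState → ℝ≥0∞} (hv : Measurable v) :
    ∫⁻ ω, v (M.next (Hist.last (H ω)) (d.toFun (H ω)) (M.Z k ω)) ∂M.P =
      ∫⁻ ω, M.L v (Hist.last (H ω)) (d.toFun (H ω)) ∂M.P := by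
  have := M.isProbabilityMeasure_P
  have := Measure.isProbabilityMeasure_map (μ := M.P) (M.measurable_Z k).aemeasurable
  let F : M.Hist n × S → ℝ≥0∞ := fun p => v (M.next (Hist.last p.1) (d.toFun p.1) p.2)
  have hF : Measurable F := hv.comp (measurable_next_rule measurable_fst d measurable_snd)
  calc ∫⁻ ω, F (H ω, M.Z k ω) ∂M.P
      = ∫⁻ p, F p ∂(M.P.map fun ω => (H ω, M.Z k ω)) :=
        (lintegral_map hF (hH.prodMk (M.measurable_Z k))).symm
    _ = ∫⁻ p, F p ∂((M.P.map H).prod (M.P.map (M.Z k))) := by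
        rw [(indepFun_iff_map_prod_eq_prod_map_map hH.aemeasurable
          (M.measurable_Z k).aemeasurable).1 hind]
    _ = ∫⁻ h, ∫⁻ z, F (h, z) ∂(M.P.map (M.Z k)) ∂(M.P.map H) :=
        lintegral_prod _ hF.aemeasurable
    _ = ∫⁻ ω, ∫⁻ z, F (H ω, z) ∂(M.P.map (M.Z k)) ∂M.P :=
        lintegral_map hF.lintegral_prod_right' hH
    _ = ∫⁻ ω, M.L v (Hist.last (H ω)) (d.toFun (H ω)) ∂M.P := by
        rw [(M.identDistrib_Z k).map_eq]
        exact lintegral_congr fun ω =>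
          lintegral_map (hF.comp measurable_prodMk_left) (M.measurable_Z 0)

theorem lintegral_histFrom_succ (π : M.Policy) (n : ℕ) (h : M.Hist n) (j : ℕ)
    {v : ExtState → ℝ≥0∞} (hv : Measurable v) :
    ∫⁻ ω, v (Hist.last (M.histFrom π n h ω (j + 1))) ∂M.P =
      ∫⁻ ω, M.L v (Hist.last (M.histFrom π n h ω j))
        ((π (n + j)).toFun (M.histFrom π n h ω j)) ∂M.P := by
  rw [← lintegral_next_rule (measurable_histFrom π n h j) (indepFun_histFrom π n h j) _ hv]
  refine lintegral_congr fun ω => ?_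
  rw [histFrom, Hist.last_append]

theorem discount_histFrom (π : M.Policy) (n : ℕ) (h : M.Hist n) (ω : Ω) (j : ℕ) :
    (Hist.last (M.histFrom π n h ω j)).2.2.1 = M.β ^ j * (Hist.last h).2.2.1 := by
  induction j with
  | zero => simp [histFrom]
  | succ j ih =>
    rw [histFrom, Hist.last_append]
    change M.β * _ = _
    rw [ih, pow_succ']
    ring

theorem cost_histFrom (π : M.Policy) (n : ℕ) (h : M.Hist n) (ω : Ω) (j : ℕ) :
    (Hist.last (M.histFrom π n h ω j)).2.1 = (Hist.last h).2.1 + (Hist.last h).2.2.1 *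
      ∑ i ∈ Finset.range j, M.β ^ i * M.stepCost (Hist.last (M.histFrom π n h ω i)).1
        ((π (n + i)).toFun (M.histFrom π n h ω i)) (M.Z (n + i) ω) := by
  induction j with
  | zero => simp [histFrom]
  | succ j ih =>
    rw [histFrom, Hist.last_append, Finset.sum_range_succ]
    change (Hist.last (M.histFrom π n h ω j)).2.1 + (Hist.last (M.histFrom π n h ω j)).2.2.1 * _ = _
    rw [ih, discount_histFrom]
    ring

/-- The terminal value function `(x,s,t) ↦ g(s)`. -/
noncomputable def terminal (g : ℝ → ℝ) (y : ExtState) : ℝ≥0∞ := ENNReal.ofReal (g y.2.1)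

theorem V_policy_eq_lintegral_terminal (g : ℝ → ℝ) (N n : ℕ) (π : M.Policy) (h : M.Hist n) :
    M.V_policy g N n π h =
      ∫⁻ ω, terminal g (Hist.last (M.histFrom π n h ω (N - n))) ∂M.P := by
  refine lintegral_congr fun ω => ?_
  rw [terminal, cost_histFrom]

theorem last_histFrom_toPolicy (π : M.MarkovPolicy) (n : ℕ) (h : M.Hist n) (ω : Ω) (j : ℕ) :
    Hist.last (M.histFrom π.toPolicy n h ω j) = M.stateFrom π n (Hist.last h) ω j := by
  induction j with
  | zero => rfl
  | succ j ih =>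
    rw [histFrom, Hist.last_append, stateFrom, ← ih]
    rfl

theorem J_policy_last (g : ℝ → ℝ) (N n : ℕ) (π : M.MarkovPolicy) (h : M.Hist n) :
    M.J_policy g N n π (Hist.last h) = M.V_policy g N n π.toPolicy h := by
  refine lintegral_congr fun ω => ?_
  simp only [costFrom, ← last_histFrom_toPolicy]
  rfl

/-- Feasibility constrains actions only, not transitions, so a constant history works. Results on
histories thus transfer to states. -/
theorem exists_hist_last_eq (M : Model A S Ω) (n : ℕ) (y : ExtState) :
    ∃ h : M.Hist n, Hist.last h = y := by
  obtain ⟨a, ha⟩ := M.actions_nonempty y.1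
  exact ⟨⟨(fun _ => y, fun _ => a), fun _ => ha⟩, rfl⟩

/-- Value iteration, started in the terminal value function. -/
noncomputable def valueIter (M : Model A S Ω) (g : ℝ → ℝ) (k : ℕ) : ExtState → ℝ≥0∞ :=
  M.bellman^[k] (terminal g)

theorem valueIter_zero (g : ℝ → ℝ) : M.valueIter g 0 = terminal g := rfl

theorem valueIter_succ (g : ℝ → ℝ) (k : ℕ) :
    M.valueIter g (k + 1) = M.bellman (M.valueIter g k) :=
  Function.iterate_succ_apply' _ _ _

theorem isRegular_terminal {g : ℝ → ℝ} (hg : Monotone g) (hc : Continuous g) :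
    IsRegular (terminal g) where
  lsc := by
    refine Continuous.lowerSemicontinuous ?_
    exact ENNReal.continuous_ofReal.comp (hc.comp (by fun_prop))
  antitone st x x' _ := le_rfl
  monotone x st st' h := ENNReal.ofReal_le_ofReal (hg (NNReal.coe_le_coe.2 h.1))

/-- Accumulated cost never decreases; this starts the monotone value iteration. -/
theorem terminal_le_L {g : ℝ → ℝ} (hg : Monotone g) (y : ExtState) (a : A) :
    terminal g y ≤ M.L (terminal g) y a := by
  have := M.isProbabilityMeasure_P
  calc terminal g y = ∫⁻ _, terminal g y ∂M.P := by simp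
    _ ≤ _ := lintegral_mono fun ω =>
      ENNReal.ofReal_le_ofReal (hg (NNReal.coe_le_coe.2 le_self_add))

theorem valueIter_mono {g : ℝ → ℝ} (hg : Monotone g) : Monotone (M.valueIter g) :=
  M.bellman_mono.monotone_iterate_of_le_map fun y => le_iInf₂ fun a _ => terminal_le_L hg y a

section Topological

variable [TopologicalSpace A]

theorem isRegular_valueIter [FirstCountableTopology A] (hM : M.IsDecreasing) {g : ℝ → ℝ}
    (hg : Monotone g) (hc : Continuous g) (k : ℕ) : IsRegular (M.valueIter g k) := by
  induction k with
  | zero => exact isRegular_terminal hg hc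
  | succ k ih => rw [valueIter_succ]; exact isRegular_bellman hM ih

/-- The mean of the iterate with `N - n - j` stages left is nondecreasing in `j`, since each rule
does no better than the infimum; at `j = N - n` it is the policy value. -/
theorem valueIter_le_V_policy [FirstCountableTopology A] (hM : M.IsDecreasing) {g : ℝ → ℝ}
    (hg : Monotone g) (hc : Continuous g) (N n : ℕ) (π : M.Policy) (h : M.Hist n) :
    M.valueIter g (N - n) (Hist.last h) ≤ M.V_policy g N n π h := by
  have := M.isProbabilityMeasure_P
  have key : ∀ j ≤ N - n, M.valueIter g (N - n) (Hist.last h) ≤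
      ∫⁻ ω, M.valueIter g (N - n - j) (Hist.last (M.histFrom π n h ω j)) ∂M.P := by
    intro j
    induction j with
    | zero => intro _; simp [histFrom]
    | succ j ih =>
      intro hj
      refine (ih (by omega)).trans ?_
      rw [lintegral_histFrom_succ π n h j (isRegular_valueIter hM hg hc _).measurable,
        show N - n - j = N - n - (j + 1) + 1 by omega, valueIter_succ]
      exact lintegral_mono fun ω => M.bellman_le _ ((π (n + j)).admissible _)
  have := key _ le_rfl
  rwa [Nat.sub_self, valueIter_zero, ← V_policy_eq_lintegral_terminal] at this

theorem V_policy_eq_valueIter [FirstCountableTopology A] (hM : M.IsDecreasing) {g : ℝ → ℝ}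
    (hg : Monotone g) (hc : Continuous g) (N n : ℕ) (π : M.MarkovPolicy)
    (hπ : ∀ m, n ≤ m → m < N → M.ruleOp (π m) (M.valueIter g (N - (m + 1))) =
      M.bellman (M.valueIter g (N - (m + 1)))) (h : M.Hist n) :
    M.V_policy g N n π.toPolicy h = M.valueIter g (N - n) (Hist.last h) := by
  have := M.isProbabilityMeasure_P
  have key : ∀ j ≤ N - n, M.valueIter g (N - n) (Hist.last h) =
      ∫⁻ ω, M.valueIter g (N - n - j) (Hist.last (M.histFrom π.toPolicy n h ω j)) ∂M.P := by
    intro j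
    induction j with
    | zero => intro _; simp [histFrom]
    | succ j ih =>
      intro hj
      rw [ih (by omega), lintegral_histFrom_succ π.toPolicy n h j
        (isRegular_valueIter hM hg hc _).measurable,
        show N - n - j = N - n - (j + 1) + 1 by omega, valueIter_succ,
        show N - n - (j + 1) = N - (n + j + 1) by omega,
        ← hπ (n + j) (by omega) (by omega)]
      rfl
  have := key _ le_rfl
  rw [Nat.sub_self, valueIter_zero, ← V_policy_eq_lintegral_terminal] at this
  exact this.symm

variable [TopologicalSpace.MetrizableSpace A] [SecondCountableTopology A] [BorelSpace A]

/-- For `m ≥ N` truncated subtraction yields `valueIter g 0`; those rules play no role. -/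
theorem exists_markovPolicy_ruleOp_eq (hM : M.IsDecreasing) {g : ℝ → ℝ}
    (hg : Monotone g) (hc : Continuous g) (N : ℕ) :
    ∃ π : M.MarkovPolicy, ∀ m, M.ruleOp (π m) (M.valueIter g (N - (m + 1))) =
      M.bellman (M.valueIter g (N - (m + 1))) := by
  choose π hπ using fun m =>
    exists_markovRule_ruleOp_eq hM (isRegular_valueIter hM hg hc (N - (m + 1)))
  exact ⟨π, hπ⟩

theorem V_eq_valueIter (hM : M.IsDecreasing) {g : ℝ → ℝ} (hg : Monotone g) (hc : Continuous g)
    (N n : ℕ) (h : M.Hist n) : M.V g N n h = M.valueIter g (N - n) (Hist.last h) := by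
  obtain ⟨π, hπ⟩ := exists_markovPolicy_ruleOp_eq hM hg hc N
  refine le_antisymm ?_ (le_iInf fun π => valueIter_le_V_policy hM hg hc N n π h)
  exact (iInf_le _ π.toPolicy).trans_eq
    (V_policy_eq_valueIter hM hg hc N n π (fun m _ _ => hπ m) h)

theorem J_eq_valueIter (hM : M.IsDecreasing) {g : ℝ → ℝ} (hg : Monotone g) (hc : Continuous g)
    (N n : ℕ) : M.J g N n = M.valueIter g (N - n) := by
  funext y
  obtain ⟨h, rfl⟩ := exists_hist_last_eq M n y
  obtain ⟨π, hπ⟩ := exists_markovPolicy_ruleOp_eq hM hg hc N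
  refine le_antisymm ?_ (le_iInf fun π => ?_)
  · refine (iInf_le _ π).trans_eq ?_
    rw [J_policy_last, V_policy_eq_valueIter hM hg hc N n π (fun m _ _ => hπ m) h]
  · rw [J_policy_last]
    exact valueIter_le_V_policy hM hg hc N n _ h

end Topological

end Model

end MarkovDecision

/-! ### Infinite horizon -/

namespace MarkovDecision

namespace Model

theorem extendTop_coe (g : ℝ → ℝ) (r : ℝ≥0) : extendTop g r = ENNReal.ofReal (g r) := by
  simp [extendTop]

/-- At a finite supremum this is continuity of `g`; at `⊤` it is the definition of `extendTop`
together with monotonicity. -/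
theorem extendTop_iSup {g : ℝ → ℝ} (hg : Monotone g) (hc : Continuous g) {r : ℕ → ℝ≥0}
    (hr : Monotone r) : extendTop g (⨆ n, (r n : ℝ≥0∞)) = ⨆ n, ENNReal.ofReal (g (r n)) := by
  by_cases htop : ⨆ n, (r n : ℝ≥0∞) = ⊤
  · rw [extendTop, if_pos htop]
    refine le_antisymm (iSup_le fun q => ?_) (iSup_le fun n =>
      le_iSup (fun q : ℝ≥0 => ENNReal.ofReal (g q)) (r n))
    obtain ⟨n, hn⟩ := lt_iSup_iff.1 (htop ▸ ENNReal.coe_lt_top : (q : ℝ≥0∞) < ⨆ n, (r n : ℝ≥0∞))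
    exact le_iSup_of_le n (ENNReal.ofReal_le_ofReal
      (hg (NNReal.coe_le_coe.2 (ENNReal.coe_lt_coe.1 hn).le)))
  · lift ⨆ n, (r n : ℝ≥0∞) to ℝ≥0 using htop with l hl
    have hlim : Tendsto r atTop (𝓝 l) := by
      rw [← ENNReal.tendsto_coe, hl]
      exact tendsto_atTop_iSup fun _ _ h => ENNReal.coe_le_coe.2 (hr h)
    have hcont : Continuous fun q : ℝ≥0 => ENNReal.ofReal (g q) :=
      ENNReal.continuous_ofReal.comp (hc.comp NNReal.continuous_coe)
    rw [extendTop_coe]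
    exact tendsto_nhds_unique ((hcont.tendsto l).comp hlim) (tendsto_atTop_iSup fun _ _ h =>
      ENNReal.ofReal_le_ofReal (hg (NNReal.coe_le_coe.2 (hr h))))

variable {A S Ω : Type*} [MeasurableSpace A] [MeasurableSpace S] [MeasurableSpace Ω]
  {M : Model A S Ω}

theorem Jinf_policy_eq_iSup {g : ℝ → ℝ} (hg : Monotone g) (hc : Continuous g)
    (π : M.MarkovPolicy) (y : ExtState) :
    M.Jinf_policy g π y = ⨆ N, M.J_policy g N 0 π y := by
  obtain ⟨h, rfl⟩ := exists_hist_last_eq M 0 y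
  have hmono : ∀ ω, Monotone fun N => (Hist.last h).2.1 + (Hist.last h).2.2.1 *
      ∑ j ∈ Finset.range N, M.β ^ j * M.costFrom π 0 (Hist.last h) ω j := fun ω N N' hN =>
    add_le_add le_rfl (mul_le_mul_right
      (Finset.sum_le_sum_of_subset (Finset.range_subset_range.2 hN)) _)
  -- Identifying partial costs with a coordinate of the random history supplies their measurability.
  have hcost : ∀ ω N, (Hist.last h).2.1 + (Hist.last h).2.2.1 *
      ∑ j ∈ Finset.range N, M.β ^ j * M.costFrom π 0 (Hist.last h) ω j =
      (Hist.last (M.histFrom π.toPolicy 0 h ω N)).2.1 := fun ω N => by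
    rw [cost_histFrom]
    simp only [costFrom, ← last_histFrom_toPolicy]
    rfl
  unfold Jinf_policy J_policy
  rw [← lintegral_iSup]
  · refine lintegral_congr fun ω => ?_
    simp only [Nat.sub_zero]
    rw [← extendTop_iSup hg hc (hmono ω)]
    congr 1
    push_cast
    rw [ENNReal.tsum_eq_iSup_nat, ENNReal.mul_iSup, ENNReal.add_iSup]
  · intro N
    simp only [Nat.sub_zero, hcost]
    exact (isRegular_terminal hg hc).measurable.comp
      (measurable_last.comp (measurable_histFrom π.toPolicy 0 h N))
  · intro N N' hN ω
    exact ENNReal.ofReal_le_ofReal (hg (NNReal.coe_le_coe.2 (hmono ω (Nat.sub_le_sub_right hN 0))))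

/-- The limit of the value iteration. -/
noncomputable def valueLim (M : Model A S Ω) (g : ℝ → ℝ) (y : ExtState) : ℝ≥0∞ :=
  ⨆ k, M.valueIter g k y

theorem valueIter_le_valueLim (g : ℝ → ℝ) (k : ℕ) : M.valueIter g k ≤ M.valueLim g :=
  fun y => le_iSup (fun k => M.valueIter g k y) k

/-- Induction by monotonicity of `bellman` alone, so competing fixed points need not be decreasing
in `x`. -/
theorem valueLim_le_of_bellman_le {g : ℝ → ℝ} {v : ExtState → ℝ≥0∞} (hv : terminal g ≤ v)
    (hfix : M.bellman v ≤ v) : M.valueLim g ≤ v := by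
  refine fun y => iSup_le fun k => ?_
  suffices h : M.valueIter g k ≤ v from h y
  induction k with
  | zero => exact hv
  | succ k ih => rw [valueIter_succ]; exact (M.bellman_mono ih).trans hfix

section Topological

variable [TopologicalSpace A]

theorem isRegular_valueLim [FirstCountableTopology A] (hM : M.IsDecreasing) {g : ℝ → ℝ}
    (hg : Monotone g) (hc : Continuous g) : IsRegular (M.valueLim g) :=
  isRegular_iSup fun k => isRegular_valueIter hM hg hc k

theorem bellman_valueLim [FirstCountableTopology A] [T2Space A] (hM : M.IsDecreasing)
    {g : ℝ → ℝ} (hg : Monotone g) (hc : Continuous g) :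
    M.bellman (M.valueLim g) = M.valueLim g := by
  refine (bellman_iSup hM (valueIter_mono hg) fun k => isRegular_valueIter hM hg hc k).trans ?_
  funext y
  simp only [← valueIter_succ]
  exact Monotone.iSup_nat_add (f := fun k => M.valueIter g k y)
    (fun i j h => valueIter_mono hg h y) 1

/-- Under a minimizer of the fixed point, the mean of `valueLim` along the trajectory is constant
and dominates the mean terminal payoff at every horizon. -/
theorem Jinf_policy_stationary_le [FirstCountableTopology A] [T2Space A]
    (hM : M.IsDecreasing) {g : ℝ → ℝ} (hg : Monotone g)
    (hc : Continuous g) (d : M.MarkovRule)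
    (hd : M.ruleOp d (M.valueLim g) = M.bellman (M.valueLim g)) (y : ExtState) :
    M.Jinf_policy g (fun _ => d) y ≤ M.valueLim g y := by
  have := M.isProbabilityMeasure_P
  rw [Jinf_policy_eq_iSup hg hc]
  refine iSup_le fun N => ?_
  obtain ⟨h, rfl⟩ := exists_hist_last_eq M 0 y
  rw [J_policy_last, V_policy_eq_lintegral_terminal]
  set π : M.MarkovPolicy := fun _ => d
  have key : ∀ j, ∫⁻ ω, M.valueLim g (Hist.last (M.histFrom π.toPolicy 0 h ω j)) ∂M.P =
      M.valueLim g (Hist.last h) := by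
    intro j
    induction j with
    | zero => simp [histFrom]
    | succ j ih =>
      rw [lintegral_histFrom_succ π.toPolicy 0 h j (isRegular_valueLim hM hg hc).measurable, ← ih]
      exact lintegral_congr fun ω => congrFun (hd.trans (bellman_valueLim hM hg hc)) _
  rw [← key (N - 0)]
  exact lintegral_mono fun ω => valueIter_le_valueLim g 0 _

variable [TopologicalSpace.MetrizableSpace A] [SecondCountableTopology A] [BorelSpace A]

theorem valueLim_le_Jinf_policy (hM : M.IsDecreasing) {g : ℝ → ℝ} (hg : Monotone g)
    (hc : Continuous g) (π : M.MarkovPolicy) (y : ExtState) :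
    M.valueLim g y ≤ M.Jinf_policy g π y := by
  rw [Jinf_policy_eq_iSup hg hc]
  refine iSup_mono fun N => ?_
  have h := congrFun (J_eq_valueIter hM hg hc N 0) y
  rw [Nat.sub_zero] at h
  exact h.symm.trans_le (iInf_le _ π)

theorem Jinf_eq_valueLim (hM : M.IsDecreasing) {g : ℝ → ℝ} (hg : Monotone g)
    (hc : Continuous g) : M.Jinf g = M.valueLim g := by
  funext y
  obtain ⟨d, hd⟩ := exists_markovRule_ruleOp_eq hM (isRegular_valueLim hM hg hc)
  exact le_antisymm ((iInf_le _ _).trans (Jinf_policy_stationary_le hM hg hc d hd y))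
    (le_iInf fun π => valueLim_le_Jinf_policy hM hg hc π y)

end Topological

/-! ### Convexity -/

theorem convexOn_terminal {g : ℝ → ℝ} (hg : ConvexOn ℝ Set.univ g) (t : Set.Ioi (0 : ℝ≥0)) :
    ConvexOn ℝ≥0 Set.univ fun xs : ℝ × ℝ≥0 => terminal g (xs.1, xs.2, t) := by
  refine ⟨convex_univ, fun u _ w _ p q hp hq hpq => ?_⟩
  have h := hg.2 (x := (u.2 : ℝ)) trivial (y := (w.2 : ℝ)) trivial p.coe_nonneg
    q.coe_nonneg (by exact_mod_cast hpq)
  simp only [terminal, Prod.snd_add, Prod.smul_snd, ENNReal.smul_def, smul_eq_mul, NNReal.coe_add,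
    NNReal.coe_mul] at h ⊢
  calc _ ≤ ENNReal.ofReal (p * g u.2 + q * g w.2) := ENNReal.ofReal_le_ofReal h
    _ ≤ _ := ENNReal.ofReal_add_le
    _ = _ := by
      rw [ENNReal.ofReal_mul p.coe_nonneg, ENNReal.ofReal_mul q.coe_nonneg, ENNReal.ofReal_coe_nnreal,
        ENNReal.ofReal_coe_nnreal]

/-- Combine minimizers at the two endpoints. Concavity of `T` and convexity of the cost give a
successor with larger `x` and smaller `s` than the combined successors, hence smaller `v`. All
successors share the weight `β t`, so convexity of `v` in `(x,s)` suffices. -/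
theorem convexOn_bellman [TopologicalSpace A] [FirstCountableTopology A]
    (hM : M.IsDecreasing) {E : Type*} [AddCommGroup E] [Module ℝ E] {ι : A → E}
    (hι : M.IsConvexModel ι) {v : ExtState → ℝ≥0∞} (hv : IsRegular v)
    (hconv : ∀ t, ConvexOn ℝ≥0 Set.univ fun xs : ℝ × ℝ≥0 => v (xs.1, xs.2, t))
    (t : Set.Ioi (0 : ℝ≥0)) :
    ConvexOn ℝ≥0 Set.univ fun xs : ℝ × ℝ≥0 => M.bellman v (xs.1, xs.2, t) := by
  refine ⟨convex_univ, fun u _ w _ p q hp hq hpq => ?_⟩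
  obtain ⟨a₁, ha₁, h₁⟩ := exists_L_eq_bellman hM hv (u.1, u.2, t)
  obtain ⟨a₂, ha₂, h₂⟩ := exists_L_eq_bellman hM hv (w.1, w.2, t)
  have hpq' : (p : ℝ) + q = 1 := by exact_mod_cast hpq
  obtain ⟨⟨x, a⟩, hxa, heq⟩ := hι.convex_D ⟨(u.1, a₁), ha₁, rfl⟩ ⟨(w.1, a₂), ha₂, rfl⟩ p.2 q.2 hpq'
  obtain ⟨hx, ha⟩ := Prod.ext_iff.1 heq
  replace hx : x = p * u.1 + q * w.1 := hx
  replace ha : ι a = (p : ℝ) • ι a₁ + (q : ℝ) • ι a₂ := ha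
  have hpt : ∀ z, v (M.next (x, p * u.2 + q * w.2, t) a z) ≤
      p * v (M.next (u.1, u.2, t) a₁ z) + q * v (M.next (w.1, w.2, t) a₂ z) := by
    intro z
    have hT := hι.concave_T z p q u.1 w.1 x a₁ a₂ a p.2 q.2 hpq' ha₁ ha₂ hxa hx ha
    have hcost : M.stepCost x a z ≤ p * M.stepCost u.1 a₁ z + q * M.stepCost w.1 a₂ z :=
      NNReal.coe_le_coe.1
        (hι.convex_cost z p q u.1 w.1 x a₁ a₂ a p.2 q.2 hpq' ha₁ ha₂ hxa hx ha)
    refine le_trans (hv.le hT (y' := (_, p * (u.2 + t.1 * M.stepCost u.1 a₁ z) +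
      q * (w.2 + t.1 * M.stepCost w.1 a₂ z), _)) ⟨?_, le_rfl⟩)
      ((hconv ⟨M.β * t.1, mul_pos M.β_pos t.2⟩).2
        (x := (M.T u.1 a₁ z, u.2 + t.1 * M.stepCost u.1 a₁ z)) trivial
        (y := (M.T w.1 a₂ z, w.2 + t.1 * M.stepCost w.1 a₂ z)) trivial hp hq hpq)
    calc p * u.2 + q * w.2 + t.1 * M.stepCost x a z
        ≤ p * u.2 + q * w.2 + t.1 * (p * M.stepCost u.1 a₁ z + q * M.stepCost w.1 a₂ z) := by
          gcongr
      _ = _ := by ring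
  have hmeas : ∀ {y : ExtState} {b : A}, b ∈ M.actions y.1 →
      Measurable fun ω => v (M.next y b (M.Z 0 ω)) := fun hb =>
    hv.measurable.comp (M.measurable_next_Z hb 0)
  calc M.bellman v ((p • u + q • w).1, (p • u + q • w).2, t)
      = M.bellman v (x, p * u.2 + q * w.2, t) := by
        rw [hx]; rfl
    _ ≤ M.L v (x, p * u.2 + q * w.2, t) a := M.bellman_le v hxa
    _ ≤ ∫⁻ ω, (p * v (M.next (u.1, u.2, t) a₁ (M.Z 0 ω)) +
          q * v (M.next (w.1, w.2, t) a₂ (M.Z 0 ω))) ∂M.P := lintegral_mono fun ω => hpt _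
    _ = p * M.L v (u.1, u.2, t) a₁ + q * M.L v (w.1, w.2, t) a₂ := by
        rw [lintegral_add_left ((hmeas ha₁).const_mul _), lintegral_const_mul _ (hmeas ha₁),
          lintegral_const_mul _ (hmeas ha₂)]
        rfl
    _ = _ := by rw [h₁, h₂]; rfl

theorem convexOn_valueIter [TopologicalSpace A] [FirstCountableTopology A]
    (hM : M.IsDecreasing) {g : ℝ → ℝ} (g_mono : Monotone g) (g_convex : ConvexOn ℝ Set.univ g)
    (g_cont : Continuous g) {E : Type*} [AddCommGroup E] [Module ℝ E] {ι : A → E}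
    (hι : M.IsConvexModel ι) (k : ℕ) (t : Set.Ioi (0 : ℝ≥0)) :
    ConvexOn ℝ≥0 Set.univ fun xs : ℝ × ℝ≥0 => M.valueIter g k (xs.1, xs.2, t) := by
  induction k generalizing t with
  | zero => exact convexOn_terminal g_convex t
  | succ k ih =>
    simp only [valueIter_succ]
    exact convexOn_bellman hM hι (isRegular_valueIter hM g_mono g_cont k) ih t

theorem convexOn_valueLim [TopologicalSpace A] [FirstCountableTopology A]
    (hM : M.IsDecreasing) {g : ℝ → ℝ} (g_mono : Monotone g) (g_convex : ConvexOn ℝ Set.univ g)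
    (g_cont : Continuous g) {E : Type*} [AddCommGroup E] [Module ℝ E] {ι : A → E}
    (hι : M.IsConvexModel ι) (t : Set.Ioi (0 : ℝ≥0)) :
    ConvexOn ℝ≥0 Set.univ fun xs : ℝ × ℝ≥0 => M.valueLim g (xs.1, xs.2, t) := by
  refine ⟨convex_univ, fun u hu w hw p q hp hq hpq => iSup_le fun k => ?_⟩
  refine ((convexOn_valueIter hM g_mono g_convex g_cont hι k t).2 hu hw hp hq hpq).trans ?_
  simp only [ENNReal.smul_def, smul_eq_mul]
  gcongr <;> exact valueIter_le_valueLim g k _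

theorem terminal_le_valueIter {g : ℝ → ℝ} (hg : Monotone g) (k : ℕ) :
    terminal g ≤ M.valueIter g k := valueIter_mono hg k.zero_le

end Model

end MarkovDecision

/-! ### Assembly of the corollary -/

open MarkovDecision Model in
theorem MarkovDecision.IsRegular.mem_potential {v : ExtState → ℝ≥0∞} (hv : IsRegular v)
    {g : ℝ → ℝ} (h : terminal g ≤ v) : v ∈ potential g :=
  ⟨hv.lsc, hv.monotone, fun x s t => h (x, s, t)⟩

theorem corollary6p4 {A S Ω : Type*}
    [TopologicalSpace A] [TopologicalSpace.MetrizableSpace A] [SecondCountableTopology A]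
    [MeasurableSpace A] [BorelSpace A] [StandardBorelSpace A]
    [MeasurableSpace S] [MeasurableSpace Ω]
    (M : MarkovDecision.Model A S Ω) (hM : M.IsDecreasing)
    (g : ℝ → ℝ) (g_mono : Monotone g) (g_convex : ConvexOn ℝ Set.univ g) (g_nonneg : 0 ≤ g 0) :
    -- finite planning horizon
    (∀ N : ℕ,
      (∀ n ≤ N,
        (∀ h : M.Hist n, M.V g N n h = M.J g N n h.last) ∧
        M.J g N n ∈ MarkovDecision.Model.potential g ∧
        (∀ s t, Antitone fun x : ℝ => M.J g N n (x, s, t)) ∧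
        (∀ x, Monotone fun st : ℝ≥0 × Set.Ioi (0 : ℝ≥0) => M.J g N n (x, st))) ∧
      (∀ x s t, M.J g N N (x, s, t) = ENNReal.ofReal (g s)) ∧
      (∀ n < N, M.J g N n = M.bellman (M.J g N (n + 1))) ∧
      (∀ n < N, ∃ d : M.MarkovRule,
        M.ruleOp d (M.J g N (n + 1)) = M.bellman (M.J g N (n + 1))) ∧
      (∀ π : M.MarkovPolicy,
        (∀ n < N, M.ruleOp (π n) (M.J g N (n + 1)) = M.bellman (M.J g N (n + 1))) →
        ∀ n ≤ N, ∀ h : M.Hist n, M.V_policy g N n π.toPolicy h = M.V g N n h)) ∧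
    -- infinite planning horizon
    IsLeast {v | v ∈ MarkovDecision.Model.potential g ∧ M.bellman v = v} (M.Jinf g) ∧
    (∀ y, Tendsto (fun N => M.J g N 0 y) atTop (𝓝 (M.Jinf g y))) ∧
    (∃ d : M.MarkovRule, M.ruleOp d (M.Jinf g) = M.bellman (M.Jinf g)) ∧
    (∀ d : M.MarkovRule, M.ruleOp d (M.Jinf g) = M.bellman (M.Jinf g) →
      ∀ y, M.Jinf_policy g (fun _ => d) y = M.Jinf g y) ∧
    (∀ s t, Antitone fun x : ℝ => M.Jinf g (x, s, t)) ∧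
    (∀ x, Monotone fun st : ℝ≥0 × Set.Ioi (0 : ℝ≥0) => M.Jinf g (x, st)) ∧
    -- the convex case
    (∀ (E : Type*) [AddCommGroup E] [Module ℝ E] (ι : A → E), M.IsConvexModel ι →
      (∀ N : ℕ, ∀ n ≤ N, ∀ t,
        ConvexOn ℝ≥0 Set.univ fun xs : ℝ × ℝ≥0 => M.J g N n (xs.1, xs.2, t)) ∧
      ∀ t, ConvexOn ℝ≥0 Set.univ fun xs : ℝ × ℝ≥0 => M.Jinf g (xs.1, xs.2, t)) := by
  -- A real-valued convex function on the whole line is continuous.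
  have g_cont : Continuous g :=
    continuousOn_univ.1 (g_convex.continuousOn isOpen_univ)
  have hJ := MarkovDecision.Model.J_eq_valueIter hM g_mono g_cont
  have hinf := MarkovDecision.Model.Jinf_eq_valueLim hM g_mono g_cont
  have hV := MarkovDecision.Model.V_eq_valueIter hM g_mono g_cont
  have hreg := MarkovDecision.Model.isRegular_valueIter hM g_mono g_cont
  have hreg' := MarkovDecision.Model.isRegular_valueLim hM g_mono g_cont
  have hfix := MarkovDecision.Model.bellman_valueLim hM g_mono g_cont
  refine ⟨fun N => ⟨fun n hn => ⟨fun h => ?_, ?_, ?_, ?_⟩, ?_, fun n hn => ?_, fun n hn => ?_,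
    fun π hπ n hn h => ?_⟩, ⟨⟨?_, ?_⟩, fun v hv => ?_⟩, fun y => ?_, ?_, fun d hd y => ?_, ?_, ?_,
    fun E _ _ ι hι => ⟨fun N n hn t => ?_, fun t => ?_⟩⟩
  · rw [hV, hJ]
  · rw [hJ]
    exact (hreg _).mem_potential (MarkovDecision.Model.terminal_le_valueIter g_mono _)
  · rw [hJ]
    exact fun s t => (hreg _).antitone (s, t)
  · rw [hJ]
    exact (hreg _).monotone
  · intro x s t
    rw [hJ, Nat.sub_self]
    rfl
  · rw [hJ, hJ, ← MarkovDecision.Model.valueIter_succ, show N - (n + 1) + 1 = N - n by omega]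
  · rw [hJ]
    exact MarkovDecision.Model.exists_markovRule_ruleOp_eq hM (hreg _)
  · rw [hV]
    refine MarkovDecision.Model.V_policy_eq_valueIter hM g_mono g_cont N n π (fun m _ hm => ?_) h
    rw [← hJ]
    exact hπ m hm
  · rw [hinf]
    exact hreg'.mem_potential (MarkovDecision.Model.valueIter_le_valueLim g 0)
  · rw [hinf, hfix]
  · rw [hinf]
    exact MarkovDecision.Model.valueLim_le_of_bellman_le (fun y => hv.1.2.2 y.1 y.2.1 y.2.2)
      hv.2.le
  · simp only [hJ, hinf, Nat.sub_zero]
    exact tendsto_atTop_iSup fun i j h => MarkovDecision.Model.valueIter_mono g_mono h y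
  · rw [hinf]
    exact MarkovDecision.Model.exists_markovRule_ruleOp_eq hM hreg'
  · rw [hinf] at hd ⊢
    exact le_antisymm
      (MarkovDecision.Model.Jinf_policy_stationary_le hM g_mono g_cont d hd y)
      (MarkovDecision.Model.valueLim_le_Jinf_policy hM g_mono g_cont _ y)
  · rw [hinf]
    exact fun s t => hreg'.antitone (s, t)
  · rw [hinf]
    exact hreg'.monotone
  · rw [hJ]
    exact MarkovDecision.Model.convexOn_valueIter hM g_mono g_convex g_cont hι _ t
  · rw [hinf]
    exact MarkovDecision.Model.convexOn_valueLim hM g_mono g_convex g_cont hι t
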